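/- Graphs may be infinite and of any cardinality; they may have parallel edges but have no loops. For distinct vertices $x,y$ of a graph $G$, let $\lambda_G(x,y)\in\mathbb N\cup\{\infty\}$ be the least number of edges whose deletion leaves $x$ and $y$ in different connected components. For an orientation $\overrightarrow G$ of $G$ (a choice of a direction for every edge), let $\overrightarrow{\lambda}(x,y)\in\mathbb N\cup\{\infty\}$ be the least number of edges whose deletion leaves no directed path from $x$ to $y$. The orientation is well-balanced if $$\overrightarrow{\lambda}(x,y)\ \ge\ \left\lfloor \tfrac12\lambda_G(x,y)\right\rfloor\qquad\text{for all distinct vertices }x,y,$$ where $\lfloor\tfrac12\infty\rfloor=\infty$. A graph is locally finite if every vertex is incident with only finitely many edges. A ray is a one-way infinite path. Two rays are equivalent if for every finite set $X$ of vertices they have tails in the same connected component of $G-X$, and edge-equivalent if for every finite set $F$ of edges they have tails in the same connected component of $G-F$. The ends and the edge-ends of $G$ are the classes of rays under the first and the second equivalence relation, respectively. "Countably many" means finitely many or countably infinitely many. **Proposition 4.4.** If every locally finite graph with countably many ends has a well-balanced orientation, then every graph with countably many edge-ends has a well-balanced orientation. -/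

import Mathlib

/-! Graphs are Mathlib's multigraphs `Graph α β` (parallel edges and loops are possible; loops are
excluded by the class `Graph.Loopless`). -/

universe u v

namespace Graph

open Relation

section Basic

variable {α : Type u} {β : Type v}

/-- The vertices `x` and `y` lie in the same connected component of `G`. -/
def Joined (G : Graph α β) (x y : α) : Prop :=
  x ∈ V(G) ∧ ReflTransGen G.Adj x y

/-- Every vertex is incident with only finitely many edges. -/
def LocallyFinite (G : Graph α β) : Prop :=
  ∀ x ∈ V(G), {e | G.Inc e x}.Finite

/-! ### Orientations and edge-connectivity -/

/-- An orientation of `G`: each edge is given a tail and a head, which are its two ends. -/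
structure Orientation (G : Graph α β) where
  /-- the vertex that the edge leaves -/
  tail : E(G) → α
  /-- the vertex that the edge enters -/
  head : E(G) → α
  isLink : ∀ e : E(G), G.IsLink e (tail e) (head e)

/-- There is a directed path from `x` to `y` that uses no edge of `F`. -/
def Orientation.DirJoinedAvoiding {G : Graph α β} (O : G.Orientation) (F : Set β) (x y : α) :
    Prop :=
  ReflTransGen (fun a b => ∃ e : E(G), (e : β) ∉ F ∧ O.tail e = a ∧ O.head e = b) x y

/-- The edge-connectivity `λ(x, y)` of two distinct vertices: the least number (possibly `⊤`) of
edges whose deletion leaves `x` and `y` in different components. -/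
noncomputable def edgeConn (G : Graph α β) (x y : α) : ℕ∞ :=
  ⨅ (F : Set β) (_ : F ⊆ E(G) ∧ ¬ (G.deleteEdges F).Joined x y), F.encard

/-- The arc-connectivity from `x` to `y`, two distinct vertices: the least number (possibly `⊤`)
of edges whose deletion leaves no directed path from `x` to `y`. -/
noncomputable def Orientation.arcConn {G : Graph α β} (O : G.Orientation) (x y : α) : ℕ∞ :=
  ⨅ (F : Set β) (_ : F ⊆ E(G) ∧ ¬ O.DirJoinedAvoiding F x y), F.encard

/-- `⌊n / 2⌋`, where half of `⊤` is `⊤`. -/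
def halfFloor (n : ℕ∞) : ℕ∞ := n.map (fun k : ℕ => k / 2)

/-- For all distinct vertices `x` and `y`, the arc-connectivity from `x` to `y` is at least
`⌊λ(x, y) / 2⌋`. -/
def Orientation.WellBalanced {G : Graph α β} (O : G.Orientation) : Prop :=
  ∀ x ∈ V(G), ∀ y ∈ V(G), x ≠ y → halfFloor (G.edgeConn x y) ≤ O.arcConn x y

/-- `G` has a well-balanced orientation. -/
def HasWellBalancedOrientation (G : Graph α β) : Prop :=
  ∃ O : G.Orientation, O.WellBalanced

/-! ### Rays, ends and edge-ends -/

/-- A ray in `G`: a one-way infinite path. -/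
structure Ray (G : Graph α β) where
  /-- the `n`-th vertex -/
  vert : ℕ → α
  /-- the `n`-th edge -/
  edge : ℕ → β
  injective : Function.Injective vert
  isLink : ∀ n, G.IsLink (edge n) (vert n) (vert (n + 1))

/-- Two rays are equivalent if, for every finite vertex set `X`, they have tails in the same
component of `G - X`. -/
def Ray.Equiv {G : Graph α β} (r s : G.Ray) : Prop :=
  ∀ X : Set α, X ⊆ V(G) → X.Finite → ∃ m n : ℕ,
    (∀ i, m ≤ i → r.vert i ∉ X) ∧ (∀ j, n ≤ j → s.vert j ∉ X) ∧
      (G.deleteVerts X).Joined (r.vert m) (s.vert n)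

/-- Two rays are edge-equivalent if, for every finite edge set `F`, they have tails in the same
component of `G - F`. -/
def Ray.EdgeEquiv {G : Graph α β} (r s : G.Ray) : Prop :=
  ∀ F : Set β, F ⊆ E(G) → F.Finite → ∃ m n : ℕ,
    (∀ i, m ≤ i → r.edge i ∉ F) ∧ (∀ j, n ≤ j → s.edge j ∉ F) ∧
      (G.deleteEdges F).Joined (r.vert m) (s.vert n)

theorem Joined.symm {G : Graph α β} {x y : α} (h : G.Joined x y) : G.Joined y x := by
  obtain ⟨hx, h⟩ := h
  refine ⟨?_, (ReflTransGen.stdSymm (r := G.Adj)).symm _ _ h⟩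
  rcases h.cases_tail with h | ⟨c, _, h⟩
  · exact h ▸ hx
  · exact h.right_mem

theorem Joined.trans {G : Graph α β} {x y z : α} (h : G.Joined x y) (h' : G.Joined y z) :
    G.Joined x z :=
  ⟨h.1, h.2.trans h'.2⟩

theorem Joined.of_path {G : Graph α β} (f : ℕ → α) (m : ℕ) (hm : f m ∈ V(G))
    (h : ∀ i, m ≤ i → G.Adj (f i) (f (i + 1))) (n : ℕ) (hn : m ≤ n) : G.Joined (f m) (f n) := by
  induction n, hn using Nat.le_induction with
  | base => exact ⟨hm, .refl⟩
  | succ k hk ih => exact ⟨hm, ih.2.tail (h k hk)⟩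

theorem Ray.joined_deleteVerts {G : Graph α β} (r : G.Ray) {X : Set α} {m n : ℕ}
    (hm : ∀ i, m ≤ i → r.vert i ∉ X) (hn : ∀ i, n ≤ i → r.vert i ∉ X) :
    (G.deleteVerts X).Joined (r.vert m) (r.vert n) := by
  have key : ∀ a b : ℕ, (∀ i, a ≤ i → r.vert i ∉ X) → a ≤ b →
      (G.deleteVerts X).Joined (r.vert a) (r.vert b) := by
    intro a b ha hab
    refine Joined.of_path r.vert a ?_ (fun i hi => ⟨r.edge i, ?_⟩) b hab
    · rw [vertexSet_deleteVerts]
      exact ⟨(r.isLink a).left_mem, ha a le_rfl⟩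
    · rw [deleteVerts_isLink]
      exact ⟨r.isLink i, ha i hi, ha (i + 1) (by lia)⟩
  rcases le_total m n with h | h
  · exact key m n hm h
  · exact (key n m hn h).symm

theorem Ray.joined_deleteEdges {G : Graph α β} (r : G.Ray) {F : Set β} {m n : ℕ}
    (hm : ∀ i, m ≤ i → r.edge i ∉ F) (hn : ∀ i, n ≤ i → r.edge i ∉ F) :
    (G.deleteEdges F).Joined (r.vert m) (r.vert n) := by
  have key : ∀ a b : ℕ, (∀ i, a ≤ i → r.edge i ∉ F) → a ≤ b →
      (G.deleteEdges F).Joined (r.vert a) (r.vert b) := by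
    intro a b ha hab
    refine Joined.of_path r.vert a ?_
      (fun i hi => ⟨r.edge i, ?_⟩) b hab
    · rw [vertexSet_deleteEdges]
      exact (r.isLink a).left_mem
    · rw [deleteEdges_isLink]
      exact ⟨r.isLink i, ha i hi⟩
  rcases le_total m n with h | h
  · exact key m n hm h
  · exact (key n m hn h).symm

theorem Ray.edge_injective {G : Graph α β} (r : G.Ray) : Function.Injective r.edge := by
  intro i j hij
  have h := r.isLink i
  rw [hij] at h
  rcases h.eq_and_eq_or_eq_and_eq (r.isLink j) with h | h
  · exact r.injective h.1
  · have h1 := r.injective h.1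
    have h2 := r.injective h.2
    lia

theorem exists_tail_notMem {γ : Type*} {f : ℕ → γ} (hf : Function.Injective f) {S : Set γ}
    (hS : S.Finite) : ∃ m, ∀ i, m ≤ i → f i ∉ S := by
  obtain ⟨m, hm⟩ := (hS.preimage hf.injOn).bddAbove
  exact ⟨m + 1, fun i hi h => by have := hm h; lia⟩

/-- Equivalence of rays. -/
def endSetoid (G : Graph α β) : Setoid G.Ray where
  r := Ray.Equiv
  iseqv :=
    { refl := fun r X _ hX => by
        obtain ⟨m, hm⟩ := exists_tail_notMem r.injective hX
        exact ⟨m, m, hm, hm, r.joined_deleteVerts hm hm⟩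
      symm := fun h X hXV hX => by
        obtain ⟨m, n, hm, hn, hj⟩ := h X hXV hX
        exact ⟨n, m, hn, hm, hj.symm⟩
      trans := fun {_ s _} h h' X hXV hX => by
        obtain ⟨m, n, hm, hn, hj⟩ := h X hXV hX
        obtain ⟨n', p, hn', hp, hj'⟩ := h' X hXV hX
        exact ⟨m, p, hm, hp, (hj.trans (s.joined_deleteVerts hn hn')).trans hj'⟩ }

/-- Edge-equivalence of rays. -/
def edgeEndSetoid (G : Graph α β) : Setoid G.Ray where
  r := Ray.EdgeEquiv
  iseqv :=
    { refl := fun r F _ hF => by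
        obtain ⟨m, hm⟩ := exists_tail_notMem r.edge_injective hF
        exact ⟨m, m, hm, hm, r.joined_deleteEdges hm hm⟩
      symm := fun h F hFE hF => by
        obtain ⟨m, n, hm, hn, hj⟩ := h F hFE hF
        exact ⟨n, m, hn, hm, hj.symm⟩
      trans := fun {_ s _} h h' F hFE hF => by
        obtain ⟨m, n, hm, hn, hj⟩ := h F hFE hF
        obtain ⟨n', p, hn', hp, hj'⟩ := h' F hFE hF
        exact ⟨m, p, hm, hp, (hj.trans (s.joined_deleteEdges hn hn')).trans hj'⟩ }

/-- The ends of `G`: the equivalence classes of rays. -/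
def Ends (G : Graph α β) : Type (max u v) := Quotient G.endSetoid

/-- The edge-ends of `G`: the edge-equivalence classes of rays. -/
def EdgeEnds (G : Graph α β) : Type (max u v) := Quotient G.edgeEndSetoid

end Basic

end Graph

/-! The proof reduces to countably many edges, then from there to locally finite graphs.

Uncountable case, by induction on the number of edges. The edge set is partitioned into smaller
parts that are `Faithful`: a finite subset of a part that separates two of its vertices within the
part separates them in `G`. A faithful part inherits edge-connectivities between its vertices and
has no more edge-ends than `G`, so induction orients it. The orientations combine, because
`k`-edge-connected vertices are joined by a chain of vertices whose consecutive members share a part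
and are `k`-edge-connected in `G` (`EdgeConnGE.reflTransGen_of_stepChain`). The parts come from a
transfinite chain of edge sets closed under small separators and suitable finite walks
(`exists_partition_linked`), whose successive differences are split into components.

Countable case. Number the edges and blow up each non-isolated vertex to a column, a ray whose
multiplicities grow, attaching edge number `n` at height `n`. This `ladder` is locally finite. High
up in the columns it is as edge-connected as `G` up to any prescribed finite bound, so contracting
the columns turns a well-balanced orientation of it into one of `G`. Each of its ends belongs to a
column or projects to an edge-end of `G`, so there are countably many. -/

namespace Graph
open Relation Set

/-! ### Walks in edge sets, edge-connectivity and faithful sets. -/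

section Linked
variable {α : Type u} {β : Type v} {G : Graph α β} {S T F : Set β} {x y z : α}

/-- `x` and `y` are joined by a walk of `G` all of whose edges lie in `S`. -/
def Linked (G : Graph α β) (S : Set β) (x y : α) : Prop :=
  ReflTransGen (fun a b => ∃ e ∈ S, G.IsLink e a b) x y

theorem Linked.refl (x : α) : G.Linked S x x := ReflTransGen.refl

theorem Linked.trans (h : G.Linked S x y) (h' : G.Linked S y z) : G.Linked S x z :=
  ReflTransGen.trans h h'

theorem Linked.symm (h : G.Linked S x y) : G.Linked S y x := by
  induction h with
  | refl => exact .refl _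
  | tail _ h ih =>
    obtain ⟨e, he, h⟩ := h
    exact .head ⟨e, he, h.symm⟩ ih

theorem Linked.mono (h : G.Linked S x y) (hST : S ∩ E(G) ⊆ T) : G.Linked T x y :=
  ReflTransGen.mono (fun _ _ ⟨e, he, hl⟩ => ⟨e, hST ⟨he, hl.edge_mem⟩, hl⟩) _ _ h

theorem IsLink.linked {e : β} (h : G.IsLink e x y) (he : e ∈ S) : G.Linked S x y :=
  .single ⟨e, he, h⟩

theorem Linked.right_mem (h : G.Linked S x y) (hx : x ∈ V(G)) : y ∈ V(G) := by
  rcases ReflTransGen.cases_tail h with h | ⟨_, _, _, _, h⟩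
  · exact h ▸ hx
  · exact h.right_mem

theorem Linked.exists_inc (h : G.Linked S x y) (hxy : x ≠ y) : ∃ e ∈ S, G.Inc e x := by
  rcases ReflTransGen.cases_head h with h | ⟨_, ⟨e, he, h⟩, _⟩
  · exact absurd h hxy
  · exact ⟨e, he, h.inc_left⟩

theorem Linked.mem_of_closed (h : G.Linked S x y) {A : Set α}
    (hA : ∀ e ∈ S, ∀ a b, G.IsLink e a b → a ∈ A → b ∈ A) (hx : x ∈ A) : y ∈ A := by
  induction h with
  | refl => exact hx
  | tail _ h ih =>
    obtain ⟨e, he, h⟩ := h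
    exact hA e he _ _ h ih

theorem linked_restrict : (G.restrict T).Linked S x y ↔ G.Linked (T ∩ S) x y := by
  unfold Linked
  simp only [restrict_isLink, mem_inter_iff]
  refine iff_of_eq (congrArg (ReflTransGen · x y) ?_)
  ext a b
  exact ⟨fun ⟨e, h1, h2, h3⟩ => ⟨e, ⟨h2, h1⟩, h3⟩, fun ⟨e, ⟨h2, h1⟩, h3⟩ => ⟨e, h1, h2, h3⟩⟩

theorem joined_deleteEdges_iff : (G.deleteEdges F).Joined x y ↔ x ∈ V(G) ∧ G.Linked Fᶜ x y := by
  unfold Joined Linked Adj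
  simp only [deleteEdges_isLink, vertexSet_deleteEdges, mem_compl_iff]
  refine and_congr_right fun _ => iff_of_eq (congrArg (ReflTransGen · x y) ?_)
  ext a b
  exact exists_congr fun e => and_comm

/-- Deleting fewer than `k` edges of `G` leaves `x` and `y` in the same component. -/
def EdgeConnGE (G : Graph α β) (k : ℕ) (x y : α) : Prop :=
  ∀ F : Set β, F.encard < k → G.Linked Fᶜ x y

theorem le_edgeConn_iff {k : ℕ} (hx : x ∈ V(G)) :
    (k : ℕ∞) ≤ G.edgeConn x y ↔ G.EdgeConnGE k x y := by
  unfold edgeConn EdgeConnGE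
  simp only [le_iInf_iff, joined_deleteEdges_iff]
  constructor
  · intro h F hF
    by_contra hn
    refine (not_lt.2 (h (F ∩ E(G)) ⟨inter_subset_right, ?_⟩))
      ((encard_le_encard inter_subset_left).trans_lt hF)
    rintro ⟨-, h2⟩
    exact hn (h2.mono fun e he hF => he.1 ⟨hF, he.2⟩)
  · rintro h F ⟨-, hF⟩
    by_contra! hn
    exact hF ⟨hx, h F hn⟩

theorem EdgeConnGE.symm {k : ℕ} (h : G.EdgeConnGE k x y) : G.EdgeConnGE k y x :=
  fun F hF => (h F hF).symm

theorem EdgeConnGE.trans {k : ℕ} (h : G.EdgeConnGE k x y) (h' : G.EdgeConnGE k y z) :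
    G.EdgeConnGE k x z :=
  fun F hF => (h F hF).trans (h' F hF)

theorem natCast_lt_halfFloor {n : ℕ∞} {f : ℕ} :
    (f : ℕ∞) < halfFloor n ↔ ((2 * f + 2 : ℕ) : ℕ∞) ≤ n := by
  induction n using ENat.recTopCoe with
  | top =>
    have h : halfFloor ⊤ = ⊤ := rfl
    simp [h]
  | coe n =>
    have h : halfFloor (n : ℕ∞) = ((n / 2 : ℕ) : ℕ∞) := rfl
    rw [h, Nat.cast_lt, Nat.cast_le]
    lia

/-- Since `f < ⌊n / 2⌋` means `2 * f + 2 ≤ n`, the inequality becomes a condition on each finite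
deleted set `F`; an infinite `F` imposes nothing. -/
theorem Orientation.wellBalanced_iff (O : G.Orientation) :
    O.WellBalanced ↔ ∀ x ∈ V(G), ∀ y ∈ V(G), ∀ F ⊆ E(G), F.Finite →
      G.EdgeConnGE (2 * F.ncard + 2) x y → O.DirJoinedAvoiding F x y := by
  constructor
  · intro h x hx y hy F hFE hF hc
    rcases eq_or_ne x y with rfl | hxy
    · exact ReflTransGen.refl
    by_contra hn
    have h1 := h x hx y hy hxy
    rw [← le_edgeConn_iff hx, ← natCast_lt_halfFloor, hF.cast_ncard_eq] at hc
    exact (hc.trans_le h1).not_ge (iInf₂_le F ⟨hFE, hn⟩)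
  · intro h x hx y hy _
    refine le_iInf₂ fun F ⟨hFE, hF⟩ => ?_
    by_contra! hn
    have hfin : F.Finite := encard_ne_top_iff.1 (ne_top_of_lt hn)
    rw [← hfin.cast_ncard_eq, natCast_lt_halfFloor, le_edgeConn_iff hx] at hn
    exact hF (h x hx y hy F hFE hfin hn)

/-- For finite `F ⊆ S`, vertices covered by `S` that `F` separates in the graph formed by `S` are
separated by `F` in all of `G`. -/
def Faithful (G : Graph α β) (S : Set β) : Prop :=
  ∀ F ⊆ S, F.Finite → ∀ x y, (∃ e ∈ S, G.Inc e x) → (∃ e ∈ S, G.Inc e y) →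
    G.Linked Fᶜ x y → G.Linked (S \ F) x y

theorem Faithful.edgeConnGE_restrict (hS : G.Faithful S) {k : ℕ} (hx : ∃ e ∈ S, G.Inc e x)
    (hy : ∃ e ∈ S, G.Inc e y) (h : G.EdgeConnGE k x y) :
    (G.restrict S).EdgeConnGE k x y := by
  intro F hF
  have hF' := (encard_le_encard (inter_subset_left (s := F) (t := S))).trans_lt hF
  rw [linked_restrict]
  exact (hS (F ∩ S) inter_subset_right (finite_of_encard_le_coe hF'.le) x y hx hy
    (h _ hF')).mono fun e he => ⟨he.1.1, fun hF => he.1.2 ⟨hF, he.1.1⟩⟩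

end Linked

/-! ### Edge-ends of faithful subgraphs. -/

section EdgeEnds
variable {α : Type u} {β : Type v} {G H : Graph α β}

/-- A ray of a subgraph, as a ray of the whole graph. -/
def Ray.ofLE (h : H ≤ G) (r : H.Ray) : G.Ray where
  vert := r.vert
  edge := r.edge
  injective := r.injective
  isLink n := h.isLink_mono (r.isLink n)

theorem Ray.edgeEquiv_iff {r s : G.Ray} : r.EdgeEquiv s ↔ ∀ F : Set β, F ⊆ E(G) → F.Finite →
    ∃ m n : ℕ, (∀ i, m ≤ i → r.edge i ∉ F) ∧ (∀ j, n ≤ j → s.edge j ∉ F) ∧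
      G.Linked Fᶜ (r.vert m) (s.vert n) := by
  simp only [Ray.EdgeEquiv, joined_deleteEdges_iff, (r.isLink _).left_mem, true_and]

/-- Faithfulness pulls a walk of `G - F` between two rays of the part back into `S \ F`, so
inclusion of rays is injective on edge-ends. -/
theorem Faithful.countable_edgeEnds {S : Set β} (hS : G.Faithful S) [hG : Countable G.EdgeEnds] :
    Countable (G.restrict S).EdgeEnds := by
  let f : (G.restrict S).EdgeEnds → G.EdgeEnds := fun q =>
    Quotient.mk G.edgeEndSetoid (q.out.ofLE restrict_le)
  refine Function.Injective.countable (f := f) fun p q hpq => ?_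
  have hpq : Ray.EdgeEquiv (p.out.ofLE restrict_le) (q.out.ofLE restrict_le) :=
    Quotient.exact hpq
  rw [← Quotient.out_eq p, ← Quotient.out_eq q]
  refine Quotient.sound (Ray.edgeEquiv_iff.2 fun F hF hfin => ?_)
  rw [edgeSet_restrict] at hF
  obtain ⟨m, n, hm, hn, h⟩ := Ray.edgeEquiv_iff.1 hpq F (hF.trans inter_subset_left) hfin
  refine ⟨m, n, hm, hn, linked_restrict.2 ?_⟩
  have key : ∀ (r : (G.restrict S).Ray) (i : ℕ), ∃ e ∈ S, G.Inc e (r.vert i) := fun r i =>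
    ⟨r.edge i, (restrict_isLink .. ▸ r.isLink i).1, (restrict_isLink .. ▸ r.isLink i).2.inc_left⟩
  exact hS F (hF.trans inter_subset_right) hfin _ _ (key _ _) (key _ _) h

end EdgeEnds
-- Combining orientations of faithful parts.
section Combine

/-- `a` and `b` are joined by a sequence of steps of `R` and `n` further steps of `T`. -/
inductive StepChain {α : Type*} (R T : α → α → Prop) : ℕ → α → α → Prop
  | nil {a b : α} : ReflTransGen R a b → StepChain R T 0 a b
  | cons {n : ℕ} {a b c d : α} : ReflTransGen R a b → T b c → StepChain R T n c d →
      StepChain R T (n + 1) a d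

theorem StepChain.exists_entering {α : Type*} {R T : α → α → Prop} {A : Set α}
    (hA : ∀ a b, R a b → b ∈ A → a ∈ A) {n : ℕ} {x y : α} (h : StepChain R T n x y)
    (hx : x ∉ A) (hy : y ∈ A) :
    ∃ m < n, ∃ a ∉ A, ∃ b ∈ A, T a b ∧ StepChain R T m b y := by
  have hA' : ∀ a b, ReflTransGen R a b → b ∈ A → a ∈ A := fun a b h hb => by
    induction h with
    | refl => exact hb
    | tail _ h ih => exact ih (hA _ _ h hb)
  induction h with
  | nil h => exact absurd (hA' _ _ h hy) hx
  | @cons n a b c d hab hbc hcd ih =>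
    by_cases hc : c ∈ A
    · exact ⟨n, n.lt_succ_self, b, fun hb => hx (hA' _ _ hab hb), c, hc, hbc, hcd⟩
    · obtain ⟨m, hm, h⟩ := ih hc hy
      exact ⟨m, hm.trans n.lt_succ_self, h⟩

variable {α : Type u} {β : Type v} {ι : Type*} {G : Graph α β} {piece : β → ι}

/-- Induction on the number of `T`-steps, the steps inside a part without a connectivity guarantee.
The first one, from `a` to `b`, is either `k`-edge-connected, hence an `R`-step, or can be replaced
by a shortcut to a later vertex of the chain. -/
theorem EdgeConnGE.reflTransGen_of_stepChain {k : ℕ}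
    (hf : ∀ i, G.Faithful (piece ⁻¹' {i})) {n : ℕ} {x y : α}
    (hc : StepChain
      (fun a b => G.EdgeConnGE k a b ∧
        ∃ i, (∃ e ∈ piece ⁻¹' {i}, G.Inc e a) ∧ ∃ e ∈ piece ⁻¹' {i}, G.Inc e b)
      (fun a b => ∃ i, ((∃ e ∈ piece ⁻¹' {i}, G.Inc e a) ∧ ∃ e ∈ piece ⁻¹' {i}, G.Inc e b) ∧
        G.Linked (piece ⁻¹' {i}) a b) n x y)
    (hk : G.EdgeConnGE k x y) :
    ReflTransGen (fun a b => G.EdgeConnGE k a b ∧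
        ∃ i, (∃ e ∈ piece ⁻¹' {i}, G.Inc e a) ∧ ∃ e ∈ piece ⁻¹' {i}, G.Inc e b) x y := by
  have hR : ∀ a b, ReflTransGen (fun a b => G.EdgeConnGE k a b ∧
      ∃ i, (∃ e ∈ piece ⁻¹' {i}, G.Inc e a) ∧ ∃ e ∈ piece ⁻¹' {i}, G.Inc e b) a b →
      G.EdgeConnGE k a b := fun a b h => by
    induction h with
    | refl => exact fun F _ => .refl _
    | tail _ h ih => exact ih.trans h.1
  induction n using Nat.strong_induction_on generalizing x y with
  | _ n ih =>
  cases hc with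
  | nil h => exact h
  | @cons n _ a b _ hxa hab hby =>
    obtain ⟨i, hcov, hlink⟩ := hab
    have hay : G.EdgeConnGE k a y := (hR _ _ hxa).symm.trans hk
    by_cases hgood : G.EdgeConnGE k a b
    · exact (hxa.tail ⟨hgood, i, hcov⟩).trans
        (ih n n.lt_succ_self hby (hgood.symm.trans hay))
    simp only [EdgeConnGE, not_forall] at hgood
    obtain ⟨F, hF, hsep⟩ := hgood
    have hF' := (encard_le_encard (inter_subset_left (s := F) (t := piece ⁻¹' {i}))).trans_lt hF
    -- By faithfulness the edges of the separator inside part `i` already separate `a` from `b`.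
    have hsep' : ¬ G.Linked (F ∩ piece ⁻¹' {i})ᶜ a b := fun h =>
      hsep ((hf i _ inter_subset_right (finite_of_encard_le_coe hF'.le) _ _ hcov.1 hcov.2 h).mono
        fun e he heF => he.1.2 ⟨heF, he.1.1⟩)
    obtain ⟨m, hm, a', ha', b', hb', ⟨j, hcov', hlink'⟩, hchain⟩ :=
      hby.exists_entering (A := {z | G.Linked (F ∩ piece ⁻¹' {i})ᶜ a z})
        (fun c d hcd hd => hd.trans (hcd.1 _ hF').symm) hsep' (hay _ hF')
    -- The chain must return to the component of `a`, since `y` lies in it, and only a `T`-step can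
    -- cross. A crossing in another part would avoid the deleted edges, so it is in part `i`, and
    -- one `T`-step from `a` to `b'` bypasses everything between.
    obtain rfl | hij := eq_or_ne j i
    · refine ih (m + 1) (by lia) (.cons hxa ⟨j, ⟨hcov.1, hcov'.2⟩, ?_⟩ hchain) hk
      exact (hf j ∅ (empty_subset _) finite_empty _ _ hcov.1 hcov'.2
        (hb'.mono (by simp))).mono (by grind)
    · refine absurd (hb'.trans (hlink'.symm.mono fun e he heF => hij ?_)) ha'
      exact he.1.symm.trans heF.2

theorem Linked.exists_stepChain {R : α → α → Prop} {S : Set β} {x y : α} (h : G.Linked S x y) :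
    ∃ n, StepChain R
      (fun a b => ∃ i, ((∃ e ∈ piece ⁻¹' {i}, G.Inc e a) ∧ ∃ e ∈ piece ⁻¹' {i}, G.Inc e b) ∧
        G.Linked (piece ⁻¹' {i}) a b) n x y := by
  induction h using ReflTransGen.head_induction_on with
  | refl => exact ⟨0, .nil .refl⟩
  | head h _ ih =>
    obtain ⟨e, -, he⟩ := h
    obtain ⟨n, hn⟩ := ih
    exact ⟨n + 1, .cons .refl ⟨piece e, ⟨⟨e, rfl, he.inc_left⟩, ⟨e, rfl, he.inc_right⟩⟩,
      he.linked rfl⟩ hn⟩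

/-- Well-balanced orientations of the parts of a partition of the edges into faithful parts combine
to a well-balanced orientation. -/
theorem HasWellBalancedOrientation.of_faithful_partition (hf : ∀ i, G.Faithful (piece ⁻¹' {i}))
    (ho : ∀ i, (G.restrict (piece ⁻¹' {i})).HasWellBalancedOrientation) :
    G.HasWellBalancedOrientation := by
  choose O hO using ho
  have hmem : ∀ e : E(G), (e : β) ∈ E(G.restrict (piece ⁻¹' {piece e})) := fun e => ⟨e.2, rfl⟩
  let P : G.Orientation :=
    { tail := fun e => (O (piece e)).tail ⟨e, hmem e⟩
      head := fun e => (O (piece e)).head ⟨e, hmem e⟩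
      isLink := fun e => ((O (piece e)).isLink ⟨e, hmem e⟩).2 }
  refine ⟨P, P.wellBalanced_iff.2 fun x hx y hy F hFE hF hk => ?_⟩
  obtain ⟨n, hn⟩ := (hk ∅ (by simp)).exists_stepChain (piece := piece)
  have hxy := hk.reflTransGen_of_stepChain hf hn
  unfold Orientation.DirJoinedAvoiding
  clear hk hn hx hy
  induction hxy with
  | refl => exact .refl
  | @tail b c _ h ih =>
    refine ih.trans ?_
    obtain ⟨hbc, i, hb, hc⟩ := h
    have hcard : (F ∩ piece ⁻¹' {i}).ncard ≤ F.ncard := ncard_le_ncard inter_subset_left hF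
    have h1 := (O i).wellBalanced_iff.1 (hO i) b
      (hb.elim fun e he => he.2.vertex_mem) c (hc.elim fun e he => he.2.vertex_mem)
      (F ∩ piece ⁻¹' {i}) (inter_subset_inter_left _ hFE) (hF.inter_of_left _)
      (fun F' hF' => (hf i).edgeConnGE_restrict hb hc hbc F' (hF'.trans_le (by gcongr)))
    refine ReflTransGen.mono ?_ _ _ h1
    rintro p q ⟨⟨e, he⟩, heF, rfl, rfl⟩
    obtain ⟨heE, hei⟩ := he
    obtain rfl : piece e = i := hei
    exact ⟨⟨e, heE⟩, fun h => heF ⟨h, rfl⟩, rfl, rfl⟩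

end Combine
-- Cardinality of closures under finitary operations.
section Closure
open Cardinal

theorem mk_iUnion_le_of_forall_le {α ι : Type u} {f : ι → Set α} {μ : Cardinal.{u}} (hμ : ℵ₀ ≤ μ)
    (hι : #ι ≤ μ) (hf : ∀ i, #(f i) ≤ μ) : #(⋃ i, f i) ≤ μ :=
  (mk_iUnion_le f).trans (mul_le_of_le hμ hι (ciSup_le' hf))

variable {β : Type u}

/-- The least set that contains `X` and is closed under the finitary operations `Φ`. -/
def closureUnder (Φ : Finset β → Set β) (X : Set β) : Set β :=
  ⋂₀ {Y | X ⊆ Y ∧ ∀ T : Finset β, ↑T ⊆ Y → Φ T ⊆ Y}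

theorem subset_closureUnder (Φ : Finset β → Set β) (X : Set β) : X ⊆ closureUnder Φ X :=
  subset_sInter fun _ h => h.1

theorem closureUnder_closed (Φ : Finset β → Set β) (X : Set β) (T : Finset β)
    (hT : ↑T ⊆ closureUnder Φ X) : Φ T ⊆ closureUnder Φ X :=
  subset_sInter fun _ h => h.2 T (hT.trans (sInter_subset_of_mem h))

/-- The operations are finitary, so the closure is exhausted after `ω` rounds, each adding at most
`μ` elements. -/
theorem mk_closureUnder_le {Φ : Finset β → Set β} {X : Set β} {μ : Cardinal.{u}} (hμ : ℵ₀ ≤ μ)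
    (hX : #X ≤ μ) (hΦ : ∀ T, #(Φ T) ≤ μ) : #(closureUnder Φ X) ≤ μ := by
  let step : Set β → Set β := fun Y => Y ∪ ⋃ T : Finset Y, Φ (T.map (Function.Embedding.subtype _))
  have hstep : ∀ n, #(step^[n] X) ≤ μ := fun n => by
    induction n with
    | zero => exact hX
    | succ n ih =>
      rw [Function.iterate_succ_apply']
      refine (mk_union_le _ _).trans (add_le_of_le hμ ih
        (mk_iUnion_le_of_forall_le hμ ?_ fun T => hΦ _))
      rcases finite_or_infinite (step^[n] X : Set β) with h | h
      · exact (lt_aleph0_of_finite _).le.trans hμ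
      · rwa [mk_finset_of_infinite]
  have hmono : Monotone fun n => step^[n] X := monotone_nat_of_le_succ fun n => by
    rw [Function.iterate_succ_apply']
    exact subset_union_left
  have hsub : closureUnder Φ X ⊆ ⋃ n : ULift.{u} ℕ, step^[n.down] X := by
    classical
    refine sInter_subset_of_mem ⟨subset_iUnion_of_subset ⟨0⟩ subset_rfl, fun T hT => ?_⟩
    obtain ⟨n, hn⟩ : ∃ n, (T : Set β) ⊆ step^[n] X := by
      refine hmono.directed_le.exists_mem_subset_of_finset_subset_biUnion (hT.trans ?_)
      exact iUnion_subset fun n => subset_iUnion (fun n => step^[n] X) n.down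
    refine subset_iUnion_of_subset ⟨n + 1⟩ ?_
    rw [Function.iterate_succ_apply']
    refine subset_union_of_subset_right (subset_iUnion_of_subset
      (T.subtype (· ∈ step^[n] X)) ?_) _
    rw [show (T.subtype (· ∈ step^[n] X)).map (Function.Embedding.subtype _) = T from
      Finset.subtype_map_of_mem hn]
  refine (mk_le_mk_of_subset hsub).trans (mk_iUnion_le_of_forall_le hμ ?_ fun n => hstep _)
  simpa using hμ

theorem exists_chain_closed {I : Type*} [LinearOrder I] [WellFoundedLT I]
    (Φ : I → Set β → Finset β → Set β) (X : I → Set β) :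
    ∃ M : I → Set β, ∀ a, M a = closureUnder (Φ a (⋃ c : Iio a, M c)) (X a ∪ ⋃ c : Iio a, M c) := by
  let step : ∀ a, (∀ c, c < a → Set β) → Set β := fun a r =>
    closureUnder (Φ a (⋃ c : Iio a, r c c.2)) (X a ∪ ⋃ c : Iio a, r c c.2)
  exact ⟨(wellFounded_lt (α := I)).fix step, fun a => (wellFounded_lt (α := I)).fix_eq step a⟩

end Closure
-- Transfinite decomposition of the edge set.
section Decomposition
open Cardinal

variable {α β : Type u} {G : Graph α β}

theorem mk_biUnion_le_of_forall_le {ι β : Type u} {s : Set ι} {f : ι → Set β} {μ : Cardinal.{u}}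
    (hμ : ℵ₀ ≤ μ) (hs : s.Finite) (hf : ∀ i ∈ s, #(f i) ≤ μ) : #(⋃ i ∈ s, f i) ≤ μ := by
  rw [biUnion_eq_iUnion]
  exact mk_iUnion_le_of_forall_le hμ (hs.lt_aleph0.le.trans hμ) fun i => hf i i.2

theorem Linked.exists_finite {S : Set β} {x y : α} (h : G.Linked S x y) :
    ∃ P ⊆ S, P.Finite ∧ G.Linked P x y := by
  induction h with
  | refl => exact ⟨∅, empty_subset _, finite_empty, .refl _⟩
  | tail _ h ih =>
    obtain ⟨e, he, h⟩ := h
    obtain ⟨P, hPS, hP, hxP⟩ := ih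
    exact ⟨insert e P, insert_subset he hPS, hP.insert e,
      (hxP.mono (inter_subset_left.trans (subset_insert e P))).tail ⟨e, mem_insert e P, h⟩⟩

theorem exists_finite_linked_of_linked (G : Graph α β) (S : Set β) (x y : α) :
    ∃ P : Set β, P.Finite ∧ P ⊆ S ∧ (G.Linked S x y → G.Linked P x y) := by
  by_cases h : G.Linked S x y
  · obtain ⟨P, hPS, hP, h⟩ := h.exists_finite
    exact ⟨P, hP, hPS, fun _ => h⟩
  · exact ⟨∅, finite_empty, empty_subset _, fun h' => absurd h' h⟩

theorem Linked.linked_union_or {N F : Set β} {x y : α} (h : G.Linked Fᶜ x y) :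
    G.Linked (N ∪ F)ᶜ x y ∨ ∃ u, (∃ e ∈ N, G.Inc e u) ∧ G.Linked (N ∪ F)ᶜ x u := by
  induction h with
  | refl => exact .inl (.refl _)
  | @tail b c _ h ih =>
    rcases ih with ih | ih
    · obtain ⟨e, he, h⟩ := h
      by_cases heN : e ∈ N
      · exact .inr ⟨b, ⟨e, heN, h.inc_left⟩, ih⟩
      · exact .inl (ih.tail ⟨e, fun h => h.elim heN he, h⟩)
    · exact .inr ih

/-- Follow the walk avoiding `F` from each end until it first meets `N`, at `u` and `v`. These are
joined outside `N` through `x` and `y`, so `hN` joins them outside `N ∪ F`. -/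
theorem Linked.linked_union {N F : Set β} {x y : α}
    (hN : ∀ u v, (∃ e ∈ N, G.Inc e u) → (∃ e ∈ N, G.Inc e v) → G.Linked Nᶜ u v →
      G.Linked (N ∪ F)ᶜ u v)
    (h : G.Linked Fᶜ x y) (h' : G.Linked Nᶜ x y) : G.Linked (N ∪ F)ᶜ x y := by
  have hsub : (N ∪ F)ᶜ ∩ E(G) ⊆ Nᶜ := fun e he heN => he.1 (.inl heN)
  rcases h.linked_union_or (N := N) with h1 | ⟨u, hu, hxu⟩
  · exact h1
  rcases h.symm.linked_union_or (N := N) with h1 | ⟨v, hv, hyv⟩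
  · exact h1.symm
  exact (hxu.trans (hN u v hu hv (((hxu.mono hsub).symm.trans h').trans (hyv.mono hsub)))).trans
    hyv.symm

/-- Take the least `a₀` whose size bound admits a separator and place that separator inside `Iio a₀
×ˢ univ`; every larger initial segment then contains it, so one enumeration serves all `a`. -/
theorem exists_separator_enumeration {I : Type u} [LinearOrder I] [WellFoundedLT I]
    [Nonempty β] (G : Graph α β) (x y : α) :
    ∃ g : I × ℕ → β, ∀ a, (∃ T : Set β, #T ≤ #(Iio a ×ˢ Set.univ : Set (I × ℕ)) ∧ ¬ G.Linked Tᶜ x y) →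
      ¬ G.Linked (g '' (Iio a ×ˢ Set.univ))ᶜ x y := by
  classical
  by_cases! h : ∃ a : I, ∃ T : Set β, #T ≤ #(Iio a ×ˢ Set.univ : Set (I × ℕ)) ∧ ¬ G.Linked Tᶜ x y
  swap
  · exact ⟨fun _ => Classical.arbitrary β, fun a ⟨T, hT, hn⟩ => absurd (h a T hT) hn⟩
  obtain ⟨a₀, ⟨T, hT, hsep⟩, hmin⟩ := (wellFounded_lt (α := I)).has_min _ h
  obtain ⟨φ⟩ := hT
  refine ⟨fun p => if h : ∃ t, (φ t : I × ℕ) = p then h.choose else Classical.arbitrary β,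
    fun a ha hl => hsep (hl.mono fun e he heT => he.1 ?_)⟩
  have haa : a₀ ≤ a := not_lt.1 (hmin a ha)
  have hex : ∃ t, (φ t : I × ℕ) = φ ⟨e, heT⟩ := ⟨_, rfl⟩
  refine ⟨φ ⟨e, heT⟩, ⟨(φ ⟨e, heT⟩).2.1.trans_le haa, mem_univ _⟩, ?_⟩
  dsimp only
  rw [dif_pos hex, φ.injective (Subtype.ext hex.choose_spec)]

/-- The edge set of an uncountable graph is partitioned into smaller sets `D a` such that, for
finite `F ⊆ D a`, vertices in the same component of the graph formed by `D a` that are separated by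
`F` in this graph are separated by `F` in the whole graph. -/
theorem exists_partition_linked (hG : ℵ₀ < #E(G)) :
    ∃ (I : Type u) (D : I → Set β), Nonempty I ∧ (∀ e ∈ E(G), ∃ a, e ∈ D a) ∧
      (∀ a b e, e ∈ D a → e ∈ D b → a = b) ∧ (∀ a, #(D a) < #E(G)) ∧
      ∀ a, ∀ F ⊆ D a, F.Finite → ∀ x y, G.Linked (D a) x y → G.Linked Fᶜ x y →
        G.Linked (D a \ F) x y := by
  classical
  obtain ⟨I, _, _, hord, ⟨ε⟩⟩ : ∃ (I : Type u) (_ : LinearOrder I) (_ : WellFoundedLT I),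
      (∀ a : I, #(Iic a) < #E(G)) ∧ Nonempty (I ≃ E(G)) :=
    ⟨(#E(G)).ord.ToType, inferInstance, inferInstance,
      fun a => by simpa using mk_Iic_lt a (by simp) (by simpa using hG.le),
      Cardinal.eq.1 (by simp)⟩
  have hI : Nonempty I := mk_ne_zero_iff.1 (by rw [mk_congr ε]; exact (aleph0_pos.trans hG).ne')
  have hβ : Nonempty β := hI.map fun i => (ε i : β)
  choose g hg using fun x y => exists_separator_enumeration (I := I) G x y
  choose P hPfin hPsub hP using G.exists_finite_linked_of_linked
  let V : Finset β → Set α := fun T => {x | ∃ e ∈ T, G.Inc e x}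
  have hV : ∀ T, (V T).Finite := fun T => by
    refine (T.finite_toSet.biUnion (t := fun e => {x | G.Inc e x}) fun e _ => ?_).subset
      fun x ⟨e, he, hx⟩ => mem_biUnion he hx
    by_cases he : e ∈ E(G)
    · obtain ⟨p, q, hpq⟩ := exists_isLink_of_mem_edgeSet he
      exact (toFinite {p, q}).subset fun x hx => hx.eq_or_eq_of_isLink hpq
    · exact finite_empty.subset fun x hx => he hx.edge_mem
  -- `Iic a` rather than `Iio a`: the separator edges with index `b` must already be available at
  -- stage `b` itself, so that all those below `a` lie in `N a`.
  let Φ : I → Set β → Finset β → Set β := fun a N T =>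
    ⋃ x ∈ V T, ⋃ y ∈ V T, (g x y '' (Iic a ×ˢ Set.univ) ∪ ⋃ F ∈ T.powerset, P (N ∪ F)ᶜ x y)
  obtain ⟨M, hM⟩ := exists_chain_closed Φ fun a => {(ε a : β)}
  let N : I → Set β := fun a => ⋃ c : Iio a, M c
  have hself : ∀ a, (ε a : β) ∈ M a := fun a =>
    hM a ▸ subset_closureUnder _ _ (.inl rfl)
  have hNM : ∀ a, N a ⊆ M a := fun a => by
    rw [hM a]
    exact subset_union_right.trans (subset_closureUnder _ _)
  have hMN : ∀ {a b}, a < b → M a ⊆ N b := fun {a b} h => subset_iUnion (fun c : Iio b => M c) ⟨a, h⟩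
  have hmono : Monotone M := fun a b h => h.eq_or_lt.elim (fun h => h ▸ subset_rfl)
    fun h => (hMN h).trans (hNM b)
  have hΦM : ∀ a (T : Finset β), ↑T ⊆ M a → Φ a (N a) T ⊆ M a := fun a T hT => by
    rw [hM a] at hT ⊢
    exact closureUnder_closed _ _ T hT
  have hinc : ∀ a, ℵ₀ ≤ #(Iic a ×ˢ Set.univ : Set (I × ℕ)) := fun a =>
    aleph0_le_mk_iff.2 (((Set.infinite_univ (α := ℕ)).prod_right ⟨a, mem_Iic.2 le_rfl⟩).to_subtype)
  have hsize : ∀ a, #(M a) ≤ #(Iic a ×ˢ Set.univ : Set (I × ℕ)) := fun a => by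
    induction a using (wellFounded_lt (α := I)).induction with
    | _ a ih =>
    have hle : #(Iio a) ≤ #(Iic a ×ˢ Set.univ : Set (I × ℕ)) :=
      mk_le_of_injective (f := fun c => ⟨(c, 0), c.2.le, mem_univ _⟩) fun c d h => by
        simpa [Subtype.ext_iff] using h
    rw [hM a]
    refine mk_closureUnder_le (hinc a) ((mk_union_le _ _).trans (add_le_of_le (hinc a) ?_ ?_)) ?_
    · rw [mk_singleton]
      exact one_le_aleph0.trans (hinc a)
    · refine mk_iUnion_le_of_forall_le (hinc a) hle fun c => (ih c c.2).trans (mk_le_mk_of_subset ?_)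
      exact prod_mono_left (Iic_subset_Iic.2 (le_of_lt c.2))
    · intro T
      refine mk_biUnion_le_of_forall_le (hinc a) (hV T) fun x _ =>
        mk_biUnion_le_of_forall_le (hinc a) (hV T) fun y _ => (mk_union_le _ _).trans
          (add_le_of_le (hinc a) ?_ ?_)
      · exact mk_image_le
      · exact mk_biUnion_le_of_forall_le (hinc a) T.powerset.finite_toSet fun F _ =>
          (hPfin _ x y).lt_aleph0.le.trans (hinc a)
  have hNsize : ∀ a, (Iio a).Nonempty → #(N a) ≤ #(Iio a ×ˢ Set.univ : Set (I × ℕ)) ∧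
      ℵ₀ ≤ #(Iio a ×ˢ Set.univ : Set (I × ℕ)) := fun a ha => by
    have hinf : ℵ₀ ≤ #(Iio a ×ˢ Set.univ : Set (I × ℕ)) :=
      aleph0_le_mk_iff.2 (((Set.infinite_univ (α := ℕ)).prod_right ha).to_subtype)
    refine ⟨mk_iUnion_le_of_forall_le hinf ?_ fun c => (hsize c).trans (mk_le_mk_of_subset ?_), hinf⟩
    · exact mk_le_of_injective (f := fun c => ⟨(c, 0), c.2, mem_univ _⟩) fun c d h => by
        simpa [Subtype.ext_iff] using h
    · exact prod_mono_left fun d hd => lt_of_le_of_lt hd c.2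
  -- If `N a ∪ F` separated `x` from `y`, it would be small enough for the enumerated separator to
  -- work; but that separator lies inside `N a`, which does not separate them.
  have hQ : ∀ a F, F.Finite → ∀ x y, (∃ e ∈ N a, G.Inc e x) → (∃ e ∈ N a, G.Inc e y) →
      G.Linked (N a)ᶜ x y → G.Linked (N a ∪ F)ᶜ x y := by
    intro a F hF x y ⟨e, he, hx⟩ ⟨f, hf, hy⟩ hxy
    obtain ⟨⟨c, hc⟩, he⟩ := mem_iUnion.1 he
    obtain ⟨⟨d, hd⟩, hf⟩ := mem_iUnion.1 hf
    obtain ⟨hle, hinf⟩ := hNsize a ⟨c, hc⟩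
    by_contra hn
    refine hg x y a ⟨_, (mk_union_le _ _).trans
      (add_le_of_le hinf hle (hF.lt_aleph0.le.trans hinf)), hn⟩ (hxy.mono ?_)
    refine fun i hi => ?_
    rintro ⟨⟨b, n⟩, ⟨hb, -⟩, rfl⟩
    refine hi.1 (hMN (max_lt (max_lt hc hd) hb) ?_)
    refine hΦM (max (max c d) b) {e, f} ?_ ?_
    · simp only [Finset.coe_insert, Finset.coe_singleton, insert_subset_iff, singleton_subset_iff]
      exact ⟨hmono ((le_max_left c d).trans (le_max_left _ b)) he,
        hmono ((le_max_right c d).trans (le_max_left _ b)) hf⟩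
    · refine mem_biUnion (x := x) ⟨e, by simp, hx⟩ (mem_biUnion (x := y) ⟨f, by simp, hy⟩ (.inl ?_))
      exact mem_image_of_mem _ ⟨le_max_right _ b, mem_univ _⟩
  refine ⟨I, fun a => M a \ N a, hI, fun e he => ?_, fun a b e ha hb => ?_, fun a => ?_, ?_⟩
  · obtain ⟨a, ha, hmin⟩ := (wellFounded_lt (α := I)).has_min {a | e ∈ M a}
      ⟨ε.symm ⟨e, he⟩, by simpa using hself (ε.symm ⟨e, he⟩)⟩
    refine ⟨a, ha, fun h => ?_⟩
    obtain ⟨c, hc⟩ := mem_iUnion.1 h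
    exact hmin c hc c.2
  · rcases lt_trichotomy a b with h | h | h
    · exact absurd (hMN h ha.1) hb.2
    · exact h
    · exact absurd (hMN h hb.1) ha.2
  · refine (mk_le_mk_of_subset sdiff_subset).trans_lt ((hsize a).trans_lt ?_)
    rw [mk_congr (Equiv.Set.prod _ _)]
    simpa using mul_lt_of_lt hG.le (hord a) (by simpa using hG)
  · intro a F hF hfin x y hD hxy
    rcases eq_or_ne x y with rfl | hne
    · exact .refl _
    obtain ⟨e, he, hx⟩ := hD.exists_inc hne
    obtain ⟨f, hf, hy⟩ := hD.symm.exists_inc hne.symm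
    -- The finite walk chosen outside `N a ∪ F` was put into `M a` by the closure, so it runs in `D
    -- a \ F`.
    have h := hP _ _ _ (hxy.linked_union (hQ a F hfin) (hD.mono fun i hi => hi.1.2))
    refine h.mono fun i hi => ?_
    have hi' := hPsub _ _ _ hi.1
    simp only [mem_compl_iff, mem_union, not_or] at hi'
    refine ⟨⟨hΦM a (hfin.toFinset ∪ {e, f}) ?_ ?_, hi'.1⟩, hi'.2⟩
    · simp only [Finset.coe_union, Finite.coe_toFinset, Finset.coe_insert, Finset.coe_singleton,
        union_subset_iff, insert_subset_iff, singleton_subset_iff]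
      exact ⟨hF.trans sdiff_subset, he.1, hf.1⟩
    · refine mem_biUnion (x := x) ⟨e, by simp, hx⟩ (mem_biUnion (x := y) ⟨f, by simp, hy⟩ (.inr ?_))
      refine mem_biUnion (x := hfin.toFinset)
        (Finset.mem_powerset.2 Finset.subset_union_left) ?_
      simpa using hi.1

end Decomposition
-- Faithful parts and the reduction to countable edge sets.
section Components
variable {α β : Type u} {G : Graph α β}

theorem Linked.of_inc {S : Set β} {e : β} {x y : α} (he : e ∈ S) (hx : G.Inc e x)
    (hy : G.Inc e y) : G.Linked S x y := by
  obtain ⟨z, hz⟩ := hx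
  rcases hy.eq_or_eq_of_isLink hz with rfl | rfl
  · exact .refl _
  · exact hz.linked he

open Cardinal in
/-- The edge set of an uncountable graph is partitioned into smaller faithful parts. -/
theorem exists_faithful_partition (hG : ℵ₀ < #E(G)) :
    ∃ (ι : Type u) (piece : β → ι), ∀ i, G.Faithful (piece ⁻¹' {i}) ∧
      #E(G.restrict (piece ⁻¹' {i})) < #E(G) := by
  obtain ⟨I, D, hI, hcov, hdisj, hcard, hD⟩ := exists_partition_linked hG
  have hidx : ∀ e, ∃ a, e ∈ E(G) → e ∈ D a := fun e => by
    by_cases he : e ∈ E(G)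
    · exact (hcov e he).imp fun _ h _ => h
    · exact ⟨Classical.arbitrary I, fun h => absurd h he⟩
  choose idx hidx using hidx
  let comp : β → Set α := fun e => {z | ∃ w, G.Inc e w ∧ G.Linked (D (idx e)) w z}
  have hcomp : ∀ {e w}, G.Inc e w → ∀ z, z ∈ comp e ↔ G.Linked (D (idx e)) w z :=
    fun {e w} hw z => ⟨fun ⟨w', hw', h⟩ => (Linked.of_inc (hidx e hw.edge_mem) hw hw').trans h,
      fun h => ⟨w, hw, h⟩⟩
  -- The decomposition only controls vertices in one component of `D a`; splitting `D a` into its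
  -- components makes that condition automatic.
  refine ⟨I × Set α, fun e => (idx e, comp e), fun ⟨a, C⟩ => ⟨?_, ?_⟩⟩
  · rintro F hFS hF x y ⟨e, he, hx⟩ ⟨f, hf, hy⟩ hxy
    have he1 : idx e = a := congrArg Prod.fst he
    have hf1 : idx f = a := congrArg Prod.fst hf
    have hef : comp e = comp f := (congrArg Prod.snd he).trans (congrArg Prod.snd hf).symm
    have hC : comp e = C := congrArg Prod.snd he
    have hlink : G.Linked (D a) x y := by
      have h := (hcomp hy y).2 (.refl y)
      rwa [← hef, hcomp hx, he1] at h
    have hFE : F ∩ E(G) ⊆ D a := fun i hi => by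
      have h1 : idx i = a := congrArg Prod.fst (hFS hi.1)
      exact h1 ▸ hidx i hi.2
    have h := hD a _ hFE (hF.inter_of_left _) x y hlink
      (hxy.mono fun i hi hi' => hi.1 hi'.1)
    unfold Linked at h ⊢
    clear hxy hlink hy hf
    induction h with
    | refl => exact .refl
    | @tail b c hb hbc ih =>
      obtain ⟨i, hi, hbc⟩ := hbc
      refine ih.tail ⟨i, ⟨?_, fun hiF => hi.2 ⟨hiF, hbc.edge_mem⟩⟩, hbc⟩
      have hia : idx i = a := hdisj _ _ i (hidx i hbc.edge_mem) hi.1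
      have hxb : G.Linked (D a) x b := Linked.mono hb fun j hj => hj.1.1
      refine Prod.ext hia (hC ▸ ?_)
      ext z
      change z ∈ comp i ↔ z ∈ comp e
      rw [hcomp hbc.inc_left, hcomp hx, hia, he1]
      exact ⟨hxb.trans, hxb.symm.trans⟩
  · refine (mk_le_mk_of_subset fun e he => ?_).trans_lt (hcard a)
    rw [edgeSet_restrict] at he
    have h1 : idx e = a := congrArg Prod.fst he.2
    exact h1 ▸ hidx e he.1

open Cardinal in
theorem HasWellBalancedOrientation.of_countable
    (h : ∀ (α β : Type u) (G : Graph α β), G.Loopless → E(G).Countable → Countable G.EdgeEnds →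
      G.HasWellBalancedOrientation)
    (α β : Type u) (G : Graph α β) (hG : G.Loopless) (hE : Countable G.EdgeEnds) :
    G.HasWellBalancedOrientation := by
  generalize hκ : #E(G) = κ
  induction κ using Cardinal.lt_wf.induction generalizing G with
  | _ κ ih =>
  rcases le_or_gt #E(G) ℵ₀ with hle | hlt
  · exact h α β G hG (le_aleph0_iff_set_countable.1 hle) hE
  obtain ⟨ι, piece, hpiece⟩ := exists_faithful_partition hlt
  refine .of_faithful_partition (piece := piece) (fun i => (hpiece i).1) fun i => ?_
  exact ih _ (hκ ▸ (hpiece i).2) _ ⟨fun e x hl => hG.not_isLoopAt e x (restrict_isLoopAt.1 hl).1⟩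
    (hpiece i).1.countable_edgeEnds rfl

end Components
open Filter

/-! ### The ladder: connectivity and transfer of orientations. -/

section Ladder
variable {α : Type u} {β : Type v} {G : Graph α β} {c : β → ℕ}

/-- Every non-isolated vertex `v` of `G` is replaced by a ray `(v, 0), (v, 1), …`, where `(v, n)`
and `(v, n + 1)` are joined by `n + 1` parallel edges. An edge `e` of `G` that joins `u` and `v` now
joins `(u, c e)` and `(v, c e)`. -/
def ladder (G : Graph α β) (c : β → ℕ) : Graph (α × ℕ) (β ⊕ α × ℕ × ℕ) where
  vertexSet := {p | ∃ e, G.Inc e p.1}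
  IsLink x p q := Sum.elim (fun e => G.IsLink e p.1 q.1 ∧ p.2 = c e ∧ q.2 = c e)
    (fun t => (∃ e, G.Inc e t.1) ∧ t.2.2 ≤ t.2.1 ∧
      (p = (t.1, t.2.1) ∧ q = (t.1, t.2.1 + 1) ∨ p = (t.1, t.2.1 + 1) ∧ q = (t.1, t.2.1))) x
  isLink_symm := by
    rintro (e | t) -
    · exact ⟨fun p q h => ⟨h.1.symm, h.2.2, h.2.1⟩⟩
    · exact ⟨fun p q h => ⟨h.1, h.2.1, h.2.2.symm.imp And.symm And.symm⟩⟩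
  eq_or_eq_of_isLink_of_isLink := by
    rintro (e | t) p q p' q' h h'
    · exact (h.1.left_eq_or_eq h'.1).imp (fun h1 => Prod.ext h1 (h.2.1.trans h'.2.1.symm))
        fun h1 => Prod.ext h1 (h.2.1.trans h'.2.2.symm)
    · obtain ⟨-, -, h⟩ := h
      obtain ⟨-, -, h'⟩ := h'
      grind
  left_mem_of_isLink := by
    rintro (e | t) p q h
    · exact ⟨e, h.1.inc_left⟩
    · obtain ⟨h, -, ⟨rfl, -⟩ | ⟨rfl, -⟩⟩ := h <;> exact h

theorem ladder_isLink_inl {e : β} {p q : α × ℕ} :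
    (G.ladder c).IsLink (.inl e) p q ↔ G.IsLink e p.1 q.1 ∧ p.2 = c e ∧ q.2 = c e :=
  Iff.rfl

theorem ladder_isLink_inr {v : α} {n j : ℕ} {p q : α × ℕ} :
    (G.ladder c).IsLink (.inr (v, n, j)) p q ↔ (∃ e, G.Inc e v) ∧ j ≤ n ∧
      (p = (v, n) ∧ q = (v, n + 1) ∨ p = (v, n + 1) ∧ q = (v, n)) :=
  Iff.rfl

theorem mem_vertexSet_ladder {p : α × ℕ} : p ∈ V(G.ladder c) ↔ ∃ e, G.Inc e p.1 :=
  Iff.rfl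

theorem ladder_loopless (hG : G.Loopless) : (G.ladder c).Loopless where
  not_isLoopAt := by
    rintro (e | ⟨v, n, j⟩) p h
    · exact hG.not_isLoopAt e p.1 (ladder_isLink_inl.1 h).1
    · obtain ⟨-, -, ⟨rfl, h⟩ | ⟨rfl, h⟩⟩ := ladder_isLink_inr.1 h <;> simp at h

theorem ladder_locallyFinite (hc : InjOn c E(G)) : (G.ladder c).LocallyFinite := by
  rintro ⟨v, n⟩ -
  have hfin : ({e | e ∈ E(G) ∧ c e = n} : Set β).Finite :=
    Set.Subsingleton.finite fun e he f hf => hc he.1 hf.1 (he.2.trans hf.2.symm)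
  refine ((hfin.image Sum.inl).union ((((finite_singleton v).prod
    ((finite_Iic n).prod (finite_Iic n)))).image Sum.inr)).subset ?_
  rintro (e | ⟨w, m, j⟩) ⟨q, h⟩
  · exact .inl ⟨e, ⟨h.1.edge_mem, h.2.1.symm⟩, rfl⟩
  · obtain ⟨-, hj, h⟩ := ladder_isLink_inr.1 h
    refine .inr ⟨_, ?_, rfl⟩
    simp only [mem_prod, mem_singleton_iff, mem_Iic]
    grind

/-- The level of an edge of `G.ladder c`: the edges of level `j` are those of `G` numbered `j`, and one
edge between `(v, n)` and `(v, n + 1)` for every vertex `v` and every `n ≥ j`. -/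
def ladderLevel (c : β → ℕ) : β ⊕ α × ℕ × ℕ → ℕ := Sum.elim c fun t => t.2.2

/-- The level-`n` edges of a column form a ray from height `n` upwards, which survives when `F`
misses level `n`. -/
theorem mem_ladder_iff_eventually {A : Set (α × ℕ)} {F : Set (β ⊕ α × ℕ × ℕ)}
    (hA : ∀ x ∈ Fᶜ, ∀ p q, (G.ladder c).IsLink x p q → p ∈ A → q ∈ A) {v : α}
    (hv : ∃ e, G.Inc e v) {m n : ℕ} (hn : n ∉ ladderLevel c '' F) (hmn : n ≤ m) :
    (v, m) ∈ A ↔ ∀ᶠ i in atTop, (v, i) ∈ A := by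
  have key : ∀ m, n ≤ m → ((v, m) ∈ A ↔ (v, n) ∈ A) := fun m hm => by
    induction m, hm using Nat.le_induction with
    | base => rfl
    | succ m hm ih =>
      have hF : Sum.inr (v, m, n) ∈ Fᶜ := fun h => hn ⟨_, h, rfl⟩
      rw [← ih]
      exact ⟨hA _ hF _ _ (ladder_isLink_inr.2 ⟨hv, hm, .inr ⟨rfl, rfl⟩⟩),
        hA _ hF _ _ (ladder_isLink_inr.2 ⟨hv, hm, .inl ⟨rfl, rfl⟩⟩)⟩
  constructor
  · intro h
    filter_upwards [eventually_ge_atTop n] with i hi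
    exact (key i hi).2 ((key m hmn).1 h)
  · intro h
    obtain ⟨i, hi, hni⟩ := (h.and (eventually_ge_atTop n)).exists
    exact (key m hmn).2 ((key i hni).1 hi)

theorem eventually_mem_ladder_of_isLink {A : Set (α × ℕ)} {F : Set (β ⊕ α × ℕ × ℕ)}
    (hA : ∀ x ∈ Fᶜ, ∀ p q, (G.ladder c).IsLink x p q → p ∈ A → q ∈ A) {e : β}
    (he : c e ∉ ladderLevel c '' F) {a b : α} (hab : G.IsLink e a b)
    (ha : ∀ᶠ i in atTop, (a, i) ∈ A) : ∀ᶠ i in atTop, (b, i) ∈ A :=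
  (mem_ladder_iff_eventually hA ⟨e, hab.inc_right⟩ he le_rfl).1
    (hA (.inl e) (fun h => he ⟨_, h, rfl⟩) _ _ (ladder_isLink_inl.2 ⟨hab, rfl, rfl⟩)
      ((mem_ladder_iff_eventually hA ⟨e, hab.inc_left⟩ he le_rfl).2 ha))

theorem encard_level_le (hc : InjOn c E(G)) (F : Set (β ⊕ α × ℕ × ℕ)) :
    {e | e ∈ E(G) ∧ c e ∈ ladderLevel c '' F}.encard ≤ F.encard := by
  refine le_trans ?_ (encard_image_le (ladderLevel c) F)
  rw [← (hc.mono fun e he => he.1 : InjOn c {e | e ∈ E(G) ∧ c e ∈ ladderLevel c '' F}).encard_image]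
  exact encard_le_encard (image_subset_iff.2 fun e he => he.2)

/-- Fewer than `k` deleted edges miss some level below `k`, which ties height `k` to the tail of its
column. They spoil the levels of fewer than `k` edges of `G`, and each other edge of `G` ties
together the tails of its two columns. -/
theorem EdgeConnGE.ladder (hc : InjOn c E(G)) {k : ℕ} {x y : α} (hx : ∃ e, G.Inc e x)
    (hy : ∃ e, G.Inc e y) (h : G.EdgeConnGE k x y) :
    (G.ladder c).EdgeConnGE k (x, k) (y, k) := by
  intro F hF
  obtain ⟨n, hnk, hn⟩ : ∃ n < k, n ∉ ladderLevel c '' F := by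
    by_contra! hn
    have h1 : (Iio k).encard ≤ F.encard :=
      (encard_le_encard (t := ladderLevel c '' F) fun n hn' => hn n hn').trans (encard_image_le _ _)
    rw [← Finset.coe_Iio, encard_coe_eq_coe_finsetCard, Nat.card_Iio] at h1
    exact h1.not_gt hF
  have hA : ∀ x' ∈ Fᶜ, ∀ p q, (G.ladder c).IsLink x' p q →
      p ∈ {p | (G.ladder c).Linked Fᶜ (x, k) p} → q ∈ {p | (G.ladder c).Linked Fᶜ (x, k) p} :=
    fun x' hx' p q hl hp => hp.trans (hl.linked hx')
  refine (mem_ladder_iff_eventually hA hy hn hnk.le).2 ?_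
  refine (h _ ((encard_level_le hc F).trans_lt hF)).mem_of_closed
    (A := {v | ∀ᶠ i in atTop, (v, i) ∈ {p | (G.ladder c).Linked Fᶜ (x, k) p}})
    (fun e he a b hab ha => eventually_mem_ladder_of_isLink hA
      (fun hl => he ⟨hab.edge_mem, hl⟩) hab ha) ?_
  exact (mem_ladder_iff_eventually hA hx hn hnk.le).1 (.refl _)

/-- Contracting columns sends directed paths to directed paths, and deleting edges of `G` costs the
same in both graphs. -/
theorem HasWellBalancedOrientation.of_ladder (hc : InjOn c E(G))
    (h : (G.ladder c).HasWellBalancedOrientation) : G.HasWellBalancedOrientation := by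
  obtain ⟨O, hO⟩ := h
  have hmem : ∀ e : E(G), Sum.inl (e : β) ∈ E(G.ladder c) := fun e => by
    obtain ⟨a, b, hab⟩ := exists_isLink_of_mem_edgeSet e.2
    exact (ladder_isLink_inl (p := (a, c e)) (q := (b, c e)).2 ⟨hab, rfl, rfl⟩).edge_mem
  let P : G.Orientation :=
    { tail := fun e => (O.tail ⟨_, hmem e⟩).1
      head := fun e => (O.head ⟨_, hmem e⟩).1
      isLink := fun e => (ladder_isLink_inl.1 (O.isLink ⟨_, hmem e⟩)).1 }
  refine ⟨P, P.wellBalanced_iff.2 fun x _ y _ F hFE hF hk => ?_⟩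
  rcases eq_or_ne x y with rfl | hxy
  · exact ReflTransGen.refl
  have hl := hk ∅ (by simp)
  obtain ⟨e, -, hx⟩ := hl.exists_inc hxy
  obtain ⟨f, -, hy⟩ := hl.symm.exists_inc hxy.symm
  have hcard : (Sum.inl '' F : Set (β ⊕ α × ℕ × ℕ)).ncard = F.ncard :=
    ncard_image_of_injective _ Sum.inl_injective
  have h1 := O.wellBalanced_iff.1 hO (x, 2 * F.ncard + 2) ⟨e, hx⟩ (y, 2 * F.ncard + 2) ⟨f, hy⟩
    (Sum.inl '' F) (image_subset_iff.2 fun e he => hmem ⟨e, hFE he⟩) (hF.image _)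
    (by rw [hcard]; exact hk.ladder hc ⟨e, hx⟩ ⟨f, hy⟩)
  suffices H : ∀ p q, O.DirJoinedAvoiding (Sum.inl '' F) p q → P.DirJoinedAvoiding F p.1 q.1 from
    H _ _ h1
  intro p q hpq
  induction hpq with
  | refl => exact ReflTransGen.refl
  | tail _ h ih =>
    obtain ⟨⟨e | ⟨v, n, j⟩, he⟩, heF, rfl, rfl⟩ := h
    · have heE : e ∈ E(G) := (ladder_isLink_inl.1 (O.isLink ⟨_, he⟩)).1.edge_mem
      exact ih.tail ⟨⟨e, heE⟩, fun h => heF ⟨e, h, rfl⟩, rfl, rfl⟩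
    · obtain ⟨-, -, ⟨h1, h2⟩ | ⟨h1, h2⟩⟩ := ladder_isLink_inr.1 (O.isLink ⟨_, he⟩)
      · rw [h1] at ih
        rwa [h2]
      · rw [h1] at ih
        rwa [h2]

end Ladder
-- Ends of the ladder.
section LadderEnds
variable {α : Type u} {β : Type v} {G : Graph α β} {c : β → ℕ}

/-- A walk that visits every vertex finitely often contains a ray. -/
theorem exists_ray_of_finite_visits (p : ℕ → α)
    (hp : ∀ n, p n = p (n + 1) ∨ ∃ e, G.IsLink e (p n) (p (n + 1)))
    (hfin : ∀ v, {n | p n = v}.Finite) :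
    ∃ (R : G.Ray) (t : ℕ → ℕ), StrictMono t ∧ ∀ i, R.vert i = p (t i) := by
  have hlast : ∀ n, ∃ l, n ≤ l ∧ p l = p n ∧ ∀ i, l < i → p i ≠ p n := fun n => by
    obtain ⟨l, hl, hmax⟩ := exists_max_image _ id (hfin (p n)) ⟨n, rfl⟩
    exact ⟨l, hmax n rfl, hl, fun i hi h => (hmax i h).not_gt hi⟩
  choose L hL1 hL2 hL3 using hlast
  -- Loop erasure: jump to the last visit of the current vertex, then take one step, which is a
  -- genuine edge because the vertex never recurs.
  let t : ℕ → ℕ := fun n => Nat.rec (L 0) (fun _ m => L (m + 1)) n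
  have ht : ∀ n, t (n + 1) = L (t n + 1) := fun n => rfl
  have hmono : StrictMono t := strictMono_nat_of_lt_succ fun n => by
    rw [ht]
    exact hL1 (t n + 1)
  have hnew : ∀ n i, t n < i → p i ≠ p (t n) := fun n i hi => by
    cases n with
    | zero => exact (hL2 0).symm ▸ hL3 0 i hi
    | succ n =>
      rw [ht] at hi ⊢
      rw [hL2]
      exact hL3 _ i hi
  have hedge : ∀ n, ∃ e, G.IsLink e (p (t n)) (p (t (n + 1))) := fun n => by
    rw [ht, hL2]
    exact (hp (t n)).resolve_left fun h => hnew n _ (Nat.lt_succ_self _) h.symm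
  choose e he using hedge
  refine ⟨⟨fun n => p (t n), e, fun i j hij => ?_, he⟩, t, hmono, fun i => rfl⟩
  by_contra hne
  rcases lt_or_gt_of_ne hne with h | h
  · exact hnew i _ (hmono h) hij.symm
  · exact hnew j _ (hmono h) hij

theorem Ray.ladder_step (r : (G.ladder c).Ray) (n : ℕ) :
    (r.vert n).1 = (r.vert (n + 1)).1 ∨ ∃ e, G.IsLink e (r.vert n).1 (r.vert (n + 1)).1 := by
  have h := r.isLink n
  rcases hx : r.edge n with e | ⟨v, m, j⟩ <;> rw [hx] at h
  · exact .inr ⟨e, (ladder_isLink_inl.1 h).1⟩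
  · obtain ⟨-, -, ⟨h1, h2⟩ | ⟨h1, h2⟩⟩ := ladder_isLink_inr.1 h <;> exact .inl (by rw [h1, h2])

theorem joined_ladder_column {X : Set (α × ℕ)} {v : α} (hv : ∃ e, G.Inc e v) {n a b : ℕ}
    (hX : ∀ i, n ≤ i → (v, i) ∉ X) (ha : n ≤ a) (hb : n ≤ b) :
    ((G.ladder c).deleteVerts X).Joined (v, a) (v, b) := by
  have key : ∀ a b, n ≤ a → a ≤ b → ((G.ladder c).deleteVerts X).Joined (v, a) (v, b) :=
    fun a b ha hab => by
      refine Joined.of_path (fun i => (v, i)) a ?_ (fun i hi => ⟨.inr (v, i, 0), ?_⟩) b hab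
      · rw [vertexSet_deleteVerts]
        exact ⟨hv, hX a ha⟩
      · rw [deleteVerts_isLink]
        exact ⟨ladder_isLink_inr.2 ⟨hv, i.zero_le, .inl ⟨rfl, rfl⟩⟩, hX i (ha.trans hi),
          hX (i + 1) (by lia)⟩
  rcases le_total a b with h | h
  · exact key a b ha h
  · exact (key b a hb h).symm

theorem exists_column_tail_notMem {X : Set (α × ℕ)} (hX : X.Finite) (v : α) :
    ∃ n, ∀ i, n ≤ i → (v, i) ∉ X :=
  exists_tail_notMem (f := fun i : ℕ => (v, i)) (fun _ _ h => congrArg Prod.snd h) hX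

theorem Ray.exists_visit_ge (r : (G.ladder c).Ray) {v : α}
    (hr : {n | (r.vert n).1 = v}.Infinite) (m n : ℕ) :
    ∃ i, m ≤ i ∧ (r.vert i).1 = v ∧ n ≤ (r.vert i).2 := by
  have hfin : (Iio m ∪ r.vert ⁻¹' ({v} ×ˢ Iio n)).Finite :=
    (finite_Iio m).union (((finite_singleton v).prod (finite_Iio n)).preimage r.injective.injOn)
  obtain ⟨i, hi, hi'⟩ := hr.exists_notMem_finite hfin
  refine ⟨i, not_lt.1 fun h => hi' (.inl h), hi, not_lt.1 fun h => hi' (.inr ⟨hi, h⟩)⟩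

/-- Both rays meet the column of `v` arbitrarily high, where the column avoids any given finite set.
-/
theorem Ray.equiv_of_infinite_visits {r s : (G.ladder c).Ray} {v : α}
    (hr : {n | (r.vert n).1 = v}.Infinite) (hs : {n | (s.vert n).1 = v}.Infinite) :
    r.Equiv s := by
  intro X _ hX
  obtain ⟨m, hm⟩ := exists_tail_notMem r.injective hX
  obtain ⟨n, hn⟩ := exists_tail_notMem s.injective hX
  obtain ⟨k, hk⟩ := exists_column_tail_notMem hX v
  obtain ⟨i, hmi, hi, hki⟩ := r.exists_visit_ge hr m k
  obtain ⟨j, hnj, hj, hkj⟩ := s.exists_visit_ge hs n k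
  have hv : ∃ e, G.Inc e v := hi ▸ mem_vertexSet_ladder.1 (r.isLink i).left_mem
  refine ⟨m, n, hm, hn, (r.joined_deleteVerts hm fun l hl => hm l (hmi.trans hl)).trans
    (.trans ?_ (s.joined_deleteVerts (fun l hl => hn l (hnj.trans hl)) hn))⟩
  have h := joined_ladder_column (c := c) hv hk hki hkj
  rwa [show (v, (r.vert i).2) = r.vert i from Prod.ext hi.symm rfl,
    show (v, (s.vert j).2) = s.vert j from Prod.ext hj.symm rfl] at h

/-- A ray of `G.ladder c` that visits every column finitely often eventually runs through columns
that avoid a given finite set. -/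
theorem Ray.exists_column_avoiding (r : (G.ladder c).Ray)
    (hr : ∀ v, {n | (r.vert n).1 = v}.Finite) {t : ℕ → ℕ} (ht : StrictMono t)
    {X : Set (α × ℕ)} (hX : X.Finite) (m k : ℕ) :
    ∃ i, k ≤ i ∧ m ≤ t i ∧ ∀ n, ((r.vert (t i)).1, n) ∉ X := by
  have hfin : (Iio m ∪ ⋃ v ∈ Prod.fst '' X, {n | (r.vert n).1 = v}).Finite :=
    (finite_Iio m).union ((hX.image _).biUnion fun v _ => hr v)
  obtain ⟨l, hl⟩ := exists_tail_notMem ht.injective hfin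
  refine ⟨max k l, le_max_left _ _, not_lt.1 fun h => hl _ (le_max_right k l) (.inl h), fun n hn => ?_⟩
  exact hl _ (le_max_right k l) (.inr (mem_biUnion (mem_image_of_mem _ hn) rfl))

/-- Deleting a finite `X` destroys finitely many edges, hence touches finitely many levels, and the
edges of `G` on these form a finite set `E'`. Edge-equivalence joins `R` to `S` outside `E'`, which
carries column tails to column tails; columns disjoint from `X` give access from `r` and to `s`. -/
theorem Ray.equiv_of_edgeEquiv (hc : InjOn c E(G)) {r s : (G.ladder c).Ray}
    (hr : ∀ v, {n | (r.vert n).1 = v}.Finite) (hs : ∀ v, {n | (s.vert n).1 = v}.Finite)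
    {R S : G.Ray} {t t' : ℕ → ℕ} (ht : StrictMono t) (ht' : StrictMono t')
    (hR : ∀ i, R.vert i = (r.vert (t i)).1) (hS : ∀ i, S.vert i = (s.vert (t' i)).1)
    (hRS : R.EdgeEquiv S) : r.Equiv s := by
  intro X hXV hX
  obtain ⟨m, hm⟩ := exists_tail_notMem r.injective hX
  obtain ⟨n, hn⟩ := exists_tail_notMem s.injective hX
  refine ⟨m, n, hm, hn, ?_⟩
  let A : Set (α × ℕ) := {p | ((G.ladder c).deleteVerts X).Joined (r.vert m) p}
  let F : Set (β ⊕ α × ℕ × ℕ) := ⋃ p ∈ X, {x | (G.ladder c).Inc x p}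
  have hF : F.Finite := hX.biUnion fun p hp => ladder_locallyFinite hc p (hXV hp)
  have hAX : ∀ p ∈ A, p ∉ X := fun p hp => (vertexSet_deleteVerts (G.ladder c) X ▸ hp.symm.1).2
  have hA : ∀ x ∈ Fᶜ, ∀ p q, (G.ladder c).IsLink x p q → p ∈ A → q ∈ A := fun x hx p q hl hp =>
    ⟨hp.1, hp.2.tail ⟨x, (deleteVerts_isLink ..).2 ⟨hl, hAX p hp,
      fun hq => hx (mem_biUnion hq hl.inc_right)⟩⟩⟩
  have hcol : ∀ {v a b}, (∃ e, G.Inc e v) → (∀ i, (v, i) ∉ X) → (v, a) ∈ A → (v, b) ∈ A :=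
    fun hv hvX ha => ha.trans (joined_ladder_column hv (n := 0) (fun i _ => hvX i)
      (Nat.zero_le _) (Nat.zero_le _))
  let E' : Set β := {e | e ∈ E(G) ∧ c e ∈ ladderLevel c '' F}
  have hE' : E'.Finite := finite_of_encard_le_coe
    ((encard_level_le hc F).trans_eq hF.cast_ncard_eq.symm)
  let B : Set α := {v | ∀ᶠ i in atTop, (v, i) ∈ A}
  have hB : ∀ {v w}, (G.deleteEdges E').Joined v w → v ∈ B → w ∈ B := fun h hv =>
    (joined_deleteEdges_iff.1 h).2.mem_of_closed (fun e he a b hab ha =>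
      eventually_mem_ladder_of_isLink hA (fun hl => he ⟨hab.edge_mem, hl⟩) hab ha) hv
  obtain ⟨k, l, hk, hl, hkl⟩ := hRS E' (fun e he => he.1) hE'
  obtain ⟨i, hki, hmi, hi⟩ := r.exists_column_avoiding hr ht hX m k
  obtain ⟨j, hlj, hnj, hj⟩ := s.exists_column_avoiding hs ht' hX n l
  have hiB : R.vert i ∈ B := by
    rw [hR]
    refine Eventually.of_forall fun a => hcol (mem_vertexSet_ladder.1 (r.isLink _).left_mem) hi
      (a := (r.vert (t i)).2) ?_
    exact r.joined_deleteVerts hm fun d hd => hm d (hmi.trans hd)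
  have hjB : S.vert j ∈ B :=
    hB (S.joined_deleteEdges hl fun d hd => hl d (hlj.trans hd))
      (hB hkl (hB (R.joined_deleteEdges (fun d hd => hk d (hki.trans hd)) hk) hiB))
  rw [hS] at hjB
  obtain ⟨b, hb⟩ := hjB.exists
  have h : (((s.vert (t' j)).1, (s.vert (t' j)).2) : α × ℕ) ∈ A :=
    hcol (mem_vertexSet_ladder.1 (s.isLink _).left_mem) hj hb
  exact h.trans (s.joined_deleteVerts (fun d hd => hn d (hnj.trans hd)) hn)

theorem countable_ends_ladder (hE : E(G).Countable) (hc : InjOn c E(G))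
    [hG : Countable G.EdgeEnds] : Countable (G.ladder c).Ends := by
  have hV : {v | ∃ e, G.Inc e v}.Countable := by
    refine (hE.biUnion (t := fun e _ => {v | G.Inc e v}) fun e he => ?_).mono
      fun v ⟨e, he⟩ => mem_biUnion he.edge_mem he
    obtain ⟨p, q, hpq⟩ := exists_isLink_of_mem_edgeSet he
    exact ((toFinite {p, q}).subset fun x hx => hx.eq_or_eq_of_isLink hpq).countable
  have hVc : Countable {v // ∃ e, G.Inc e v} := hV.to_subtype
  -- Each ray is labelled by a column it visits infinitely often or, failing that, by the edge-end
  -- of a ray extracted from its projection; equal labels force equivalence.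
  have hray : ∀ r : (G.ladder c).Ray, ∃ o : {v // ∃ e, G.Inc e v} ⊕ G.EdgeEnds,
      (∃ v, o = .inl v ∧ {n | (r.vert n).1 = v}.Infinite) ∨
      ((∀ v, {n | (r.vert n).1 = v}.Finite) ∧ ∃ (R : G.Ray) (t : ℕ → ℕ), StrictMono t ∧
        (∀ i, R.vert i = (r.vert (t i)).1) ∧ o = .inr (Quotient.mk G.edgeEndSetoid R)) := fun r => by
    by_cases! h : ∃ v, {n | (r.vert n).1 = v}.Infinite
    · obtain ⟨v, hv⟩ := h
      obtain ⟨i, hi⟩ := hv.nonempty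
      exact ⟨.inl ⟨v, hi ▸ mem_vertexSet_ladder.1 (r.isLink i).left_mem⟩, .inl ⟨_, rfl, hv⟩⟩
    · obtain ⟨R, t, ht, hR⟩ := exists_ray_of_finite_visits _ r.ladder_step h
      exact ⟨.inr (Quotient.mk G.edgeEndSetoid R), .inr ⟨h, R, t, ht, hR, rfl⟩⟩
  choose f hf using hray
  refine Function.Injective.countable (f := fun q : (G.ladder c).Ends => f (Quotient.out q))
    fun p q hpq => ?_
  rw [← Quotient.out_eq p, ← Quotient.out_eq q]
  refine Quotient.sound ?_
  dsimp only at hpq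
  rcases hf p.out with ⟨v, hv, hpv⟩ | ⟨hp, R, t, ht, hR, hpR⟩ <;>
    rcases hf q.out with ⟨w, hw, hqw⟩ | ⟨hq, S, t', ht', hS, hqS⟩
  · obtain rfl : v = w := Sum.inl_injective (hv.symm.trans (hpq.trans hw))
    exact Ray.equiv_of_infinite_visits hpv hqw
  · exact absurd (hv.symm.trans (hpq.trans hqS)) Sum.inl_ne_inr
  · exact absurd (hpR.symm.trans (hpq.trans hw)) Sum.inr_ne_inl
  · exact Ray.equiv_of_edgeEquiv hc hp hq ht ht' hR hS
      (Quotient.exact (Sum.inr_injective (hpR.symm.trans (hpq.trans hqS))))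

end LadderEnds
end Graph

theorem proposition4p4
    (h : ∀ (α β : Type u) (G : Graph α β), G.Loopless → G.LocallyFinite → Countable G.Ends →
      G.HasWellBalancedOrientation) :
    ∀ (α β : Type u) (G : Graph α β), G.Loopless → Countable G.EdgeEnds →
      G.HasWellBalancedOrientation := by
  refine Graph.HasWellBalancedOrientation.of_countable fun α β G hG hE hends => ?_
  obtain ⟨c, hc⟩ := Set.countable_iff_exists_injOn.1 hE
  exact .of_ladder hc (h _ _ _ (Graph.ladder_loopless hG) (Graph.ladder_locallyFinite hc)
    (Graph.countable_ends_ladder hE hc))
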